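/- Let $\mathbf A\in\{0,1\}^{m\times n}$, $\mathbf b\in\mathbb R_{\ge 0}^m$, $\mathbf w\in\mathbb R^n$, $\mathbf X\in\mathbb N^n$, and let $\mathcal P=\{\mathbf x\in\mathbb R^n : 0\le x_i\le X_i \text{ for all } i,\ \mathbf A\mathbf x\le \mathbf b\}$. **Algorithm min-sum-packing.** Let $G$ be the bipartite graph with variable vertices $v_1,\dots,v_n$ (the columns of $\mathbf A$), constraint vertices $C_1,\dots,C_m$ (the rows of $\mathbf A$), and an edge $(v_i,C_j)$ exactly when $A_{ji}=1$. Let $N(\cdot)$ denote the set of neighbours in $G$, and write $w_v,X_v$ and $b_C$ for the entries belonging to $v$ and $C$. Messages take values in $\mathbb R\cup\{-\infty\}$, and a maximum over the empty set is $-\infty$. Given a number of iterations $t\in\mathbb N$, put $\mu^{(0)}_{C\to v}(\beta)=0$ for every edge $(v,C)$ and every $\beta\in\{0,\dots,X_v\}$. For $t'=1,\dots,t$, every edge $(v,C)$ and every $\beta\in\{0,\dots,X_v\}$, put $$\mu^{(t')}_{v\to C}(\beta)=w_v\beta+\sum_{C'\in N(v)\setminus\{C\}}\mu^{(t'-1)}_{C'\to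 v}(\beta),$$ $$\mu^{(t')}_{C\to v}(\beta)=\max\Big\{\sum_{u\in N(C)\setminus\{v\}}\mu^{(t')}_{u\to C}(z_u)\ :\ \mathbf z\in\prod_{u}\{0,\dots,X_u\},\ z_v=\beta,\ \sum_{u\in N(C)}z_u\le b_C\Big\}.$$ Finally, put $$\mu_v(\beta)=w_v\beta+\sum_{C\in N(v)}\mu^{(t)}_{C\to v}(\beta),$$ let $\delta_{v,t}$ be the set of the $\beta\in\{0,\dots,X_v\}$ that maximize $\mu_v$, and output the vector $\hat{\mathbf x}$ with $\hat x_v=\max\delta_{v,t}$ if $t$ is even and $\hat x_v=\min\delta_{v,t}$ if $t$ is odd. **Theorem.** Assume that every column of $\mathbf A$ contains at most two $1$s, and that the packing linear program $\max\{\mathbf w^T\mathbf x : \mathbf x\in\mathcal P\}$ has a unique optimal solution $\mathbf x^*$, with $x^*_i\in\{0,X_i\}$ for every $i$. Let $w_{\max}=\max_i w_i$ and $$c(\mathcal P,\mathbf w)=\min_{\mathbf x\in\mathcal P\setminus\{\mathbf x^*\}}\frac{\mathbf w^T(\mathbf x^*-\mathbf x)}{\|\mathbf x^*-\mathbf x\|_1},$$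 where $w_{\max}/c(\mathcal P,\mathbf w)$ is read as $0$ if $\mathcal P=\{\mathbf x^*\}$. If $t\in\mathbb N$ satisfies $t>\dfrac{w_{\max}}{c(\mathcal P,\mathbf w)}+\dfrac12$, then the output of min-sum-packing with $t$ iterations is $\hat{\mathbf x}=\mathbf x^*$. -/

import Mathlib

namespace MinSumPacking

/-- A factor graph model `⟨G, Ψ, Φ, X⟩` with variable vertices `V` and constraint vertices `C`.
The bipartite graph `G` is given by its edge set `E ⊆ V × C`; the alphabet of the variable
vertex `v` is `{0, …, X v}`; factor functions may take the value `-∞`, written `⊥`. -/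
structure FactorGraphModel (V C : Type*) where
  /-- the edges of the bipartite graph -/
  E : Finset (V × C)
  /-- the factor functions, one for each constraint vertex -/
  ψ : C → (V → ℕ) → WithBot ℝ
  /-- the variable functions, one for each variable vertex -/
  φ : V → ℝ → ℝ
  /-- the domain boundary vector -/
  X : V → ℕ

/-- The integral box `{0, …, X₁} × ⋯ × {0, …, Xₙ}`. -/
noncomputable def zbox {V : Type*} [Fintype V] (X : V → ℕ) : Finset (V → ℕ) :=
  open Classical in Fintype.piFinset fun v => Finset.range (X v + 1)

/-- The real box `[0, X₁] × ⋯ × [0, Xₙ]`. -/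
def rbox {V : Type*} (X : V → ℕ) : Set (V → ℝ) :=
  {x | ∀ v, 0 ≤ x v ∧ x v ≤ X v}

namespace FactorGraphModel

variable {V C : Type*} [Fintype V] [Fintype C]

/-- The constraint vertices adjacent to the variable vertex `v`. -/
noncomputable def nbrV (F : FactorGraphModel V C) (v : V) : Finset C :=
  open Classical in Finset.univ.filter fun c => (v, c) ∈ F.E

/-- The variable vertices adjacent to the constraint vertex `c`. -/
noncomputable def nbrC (F : FactorGraphModel V C) (c : C) : Finset V :=
  open Classical in Finset.univ.filter fun v => (v, c) ∈ F.E

/-- Variable-to-constraint messages computed from the previous constraint-to-variable messages: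
`μ_{v→c}(β) = φ_v(β) + ∑_{c' ∈ N(v) \ {c}} μ_{c'→v}(β)`. -/
noncomputable def varUpdate (F : FactorGraphModel V C) (μ : C → V → ℕ → WithBot ℝ) :
    V → C → ℕ → WithBot ℝ :=
  open Classical in fun v c β =>
    ((F.φ v (β : ℝ) : ℝ) : WithBot ℝ) + ∑ c' ∈ (F.nbrV v).erase c, μ c' v β

/-- Constraint-to-variable messages computed from the current variable-to-constraint messages:
`μ_{c→v}(β)` is the maximum of `∑_{u ∈ N(c) \ {v}} μ_{u→c}(z_u)` over the `z` in the integral box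
with `z_v = β` and `ψ_c(z) = 0`; the maximum over the empty set is `-∞`. -/
noncomputable def conUpdate (F : FactorGraphModel V C) (ν : V → C → ℕ → WithBot ℝ) :
    C → V → ℕ → WithBot ℝ :=
  open Classical in fun c v β =>
    ((zbox F.X).filter fun z => z v = β ∧ F.ψ c z = 0).sup
      fun z => ∑ u ∈ (F.nbrC c).erase v, ν u c (z u)

/-- The constraint-to-variable messages `μ_{c→v}^{(t)}(β)` after `t` iterations, with the zero
initialization. -/
noncomputable def msgCV (F : FactorGraphModel V C) : ℕ → C → V → ℕ → WithBot ℝ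
  | 0 => fun _ _ _ => 0
  | t + 1 => F.conUpdate (F.varUpdate (F.msgCV t))

/-- The final value `μ_v(β)` after `t` iterations. -/
noncomputable def belief (F : FactorGraphModel V C) (t : ℕ) (v : V) (β : ℕ) : WithBot ℝ :=
  ((F.φ v (β : ℝ) : ℝ) : WithBot ℝ) + ∑ c ∈ F.nbrV v, F.msgCV t c v β

/-- `μ_v^max`, the maximum of `μ_v(β)` over the alphabet of `v`. -/
noncomputable def beliefMax (F : FactorGraphModel V C) (t : ℕ) (v : V) : WithBot ℝ :=
  (Finset.range (F.X v + 1)).sup (F.belief t v)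

/-- `δ_{v,t}`, the set of letters `β` of the alphabet of `v` with `μ_v(β) = μ_v^max`. -/
noncomputable def delta (F : FactorGraphModel V C) (t : ℕ) (v : V) : Finset ℕ :=
  open Classical in
    (Finset.range (F.X v + 1)).filter fun β => F.belief t v β = F.beliefMax t v

theorem delta_nonempty (F : FactorGraphModel V C) (t : ℕ) (v : V) : (F.delta t v).Nonempty := by
  obtain ⟨β, hβ, h⟩ := Finset.exists_mem_eq_sup (Finset.range (F.X v + 1))
    ⟨0, by simp⟩ (F.belief t v)
  exact ⟨β, Finset.mem_filter.2 ⟨hβ, h.symm⟩⟩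

/-- The output of the algorithm min-sum-packing with `t` iterations. -/
noncomputable def minSumPacking (F : FactorGraphModel V C) (t : ℕ) : V → ℕ := fun v =>
  if Even t then (F.delta t v).max' (F.delta_nonempty t v)
  else (F.delta t v).min' (F.delta_nonempty t v)

end FactorGraphModel

/-- The factor graph model of the packing problem with zero-one constraint matrix `A` (rows are
constraints, columns are variables), constraint vector `b`, weights `w` and boundary vector `X`. -/
noncomputable def packingModel {V C : Type*} [Fintype V] [Fintype C]
    (A : Matrix C V ℝ) (b : C → ℝ) (w : V → ℝ) (X : V → ℕ) : FactorGraphModel V C :=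
  open Classical in
  { E := Finset.univ.filter fun e => A e.2 e.1 = 1
    ψ := fun c y =>
      if ∑ v ∈ Finset.univ.filter (fun v => A c v = 1), (y v : ℝ) ≤ b c then 0 else ⊥
    φ := fun v β => w v * β
    X := X }

/-- The polytope `{x ∈ rbox X | A x ≤ b}`. -/
def packingPolytope {V C : Type*} [Fintype V]
    (A : Matrix C V ℝ) (b : C → ℝ) (X : V → ℕ) : Set (V → ℝ) :=
  {x | x ∈ rbox X ∧ ∀ c, (A.mulVec x) c ≤ b c}

/-- `argmax {wᵀ x | x ∈ P}`, the set of optimal solutions. -/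
def optSet {V : Type*} [Fintype V] (P : Set (V → ℝ)) (w : V → ℝ) : Set (V → ℝ) :=
  {x | x ∈ P ∧ ∀ y ∈ P, w ⬝ᵥ y ≤ w ⬝ᵥ x}

/-- `c(P, w)`: the minimum of `wᵀ (x* - x) / ‖x* - x‖₁` over `x ∈ P \ {x*}`, where `xs` is the
optimal solution `x*`. For `P = {x*}` the value is `0`; the quotient `w_max / c(P, w)` is then `0`,
as it is for the convention that a minimum over the empty set is `+∞`. -/
noncomputable def cGap {V : Type*} [Fintype V] (P : Set (V → ℝ)) (w xs : V → ℝ) : ℝ :=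
  sInf ((fun x => (w ⬝ᵥ (xs - x)) / ∑ i, |xs i - x i|) '' (P \ {xs}))

/-- `w_max`, the largest weight (the value on an empty index set is irrelevant). -/
noncomputable def wMax {V : Type*} (w : V → ℝ) : ℝ := ⨆ i, w i

end MinSumPacking

/-! Move a letter `β` of the variable `v` one unit towards the optimal letter. Going down the
computation tree, each constraint either absorbs the change or passes it on to one further variable
whose letter is off the optimum on the opposite side. Since a variable lies in at most two
constraints, the changes form a path: they add up to a direction `y` that is feasible at the
optimum, except for the load at an end of the path that is still to be extended.

Let `κ > 0` be the optimality gap per unit of the `1`-norm, and let `σ` be the vector of signs of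
the inward directions at the optimum. The `1`-norm of an inward direction `y` is `σ ⬝ᵥ y`, so the
optimum is still optimal for the weights `w + κ σ`. Measured with these weights, each variable on
the path contributes an extra loss of `κ`, which after `t` iterations outweighs the error of at
most `w_max` at each of the two ends where the path is cut off by the leaves of the tree. -/

namespace MinSumPacking

open scoped Matrix

section Gap

variable {V : Type*} [Fintype V] {P : Set (V → ℝ)} {w xs x : V → ℝ}

theorem dotProduct_lt_of_optSet_eq_singleton (hopt : optSet P w = {xs}) (hx : x ∈ P)
    (hne : x ≠ xs) : w ⬝ᵥ x < w ⬝ᵥ xs := by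
  have hxs : xs ∈ optSet P w := hopt ▸ rfl
  refine (hxs.2 x hx).lt_of_ne fun h => hne ?_
  have hx_opt : x ∈ optSet P w := ⟨hx, fun y hy => h ▸ hxs.2 y hy⟩
  rwa [hopt] at hx_opt

theorem eq_zero_of_optSet_eq_singleton_of_nonpos (hopt : optSet P w = {xs}) (hP : ∀ x ∈ P, 0 ≤ x)
    (h0 : 0 ∈ P) (hw : w ≤ 0) : xs = 0 := by
  have h0_opt : 0 ∈ optSet P w := ⟨h0, fun y hy => by
    rw [dotProduct_zero]
    exact Finset.sum_nonpos fun v _ => mul_nonpos_of_nonpos_of_nonneg (hw v) (hP y hy v)⟩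
  rw [hopt] at h0_opt
  exact h0_opt.symm

theorem dotProduct_sub_div_sum_abs_nonneg (hxs : xs ∈ optSet P w) (hx : x ∈ P) :
    0 ≤ (w ⬝ᵥ (xs - x)) / ∑ i, |xs i - x i| := by
  refine div_nonneg ?_ (Finset.sum_nonneg fun _ _ => abs_nonneg _)
  rw [dotProduct_sub]
  exact sub_nonneg.2 (hxs.2 x hx)

theorem cGap_nonneg (hxs : xs ∈ optSet P w) : 0 ≤ cGap P w xs := by
  refine Real.sInf_nonneg ?_
  rintro _ ⟨x, hx, rfl⟩
  exact dotProduct_sub_div_sum_abs_nonneg hxs hx.1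

theorem sum_abs_pos {d : V → ℝ} (hd : d ≠ 0) : 0 < ∑ i, |d i| := by
  obtain ⟨i, hi⟩ := Function.ne_iff.1 hd
  exact Finset.sum_pos' (fun _ _ => abs_nonneg _) ⟨i, Finset.mem_univ _, abs_pos.2 hi⟩

theorem cGap_mul_sum_abs_le (hxs : xs ∈ optSet P w) (hx : x ∈ P) :
    cGap P w xs * ∑ i, |xs i - x i| ≤ w ⬝ᵥ (xs - x) := by
  rcases eq_or_ne x xs with rfl | hne
  · simp
  have hpos : 0 < ∑ i, |xs i - x i| := sum_abs_pos (d := xs - x) (sub_ne_zero.2 hne.symm)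
  rw [← le_div_iff₀ hpos]
  refine csInf_le ⟨0, ?_⟩ ⟨x, ⟨hx, hne⟩, rfl⟩
  rintro _ ⟨y, hy, rfl⟩
  exact dotProduct_sub_div_sum_abs_nonneg hxs hy.1

theorem le_cGap {κ : ℝ} (hne : (P \ {xs}).Nonempty)
    (h : ∀ x ∈ P, κ * ∑ i, |xs i - x i| ≤ w ⬝ᵥ (xs - x)) : κ ≤ cGap P w xs := by
  refine le_csInf (hne.image _) ?_
  rintro _ ⟨x, hx, rfl⟩
  have hpos : 0 < ∑ i, |xs i - x i| := sum_abs_pos (d := xs - x) (sub_ne_zero.2 (Ne.symm hx.2))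
  exact (le_div_iff₀ hpos).2 (h x hx.1)

theorem exists_pos_mul_sum_abs_le {K : Set (V → ℝ)} (hK : IsClosed K)
    (hsmul : ∀ d ∈ K, ∀ r : ℝ, 0 ≤ r → r • d ∈ K) (hneg : ∀ d ∈ K, d ≠ 0 → w ⬝ᵥ d < 0) :
    ∃ κ > 0, ∀ d ∈ K, κ * ∑ i, |d i| ≤ -(w ⬝ᵥ d) := by
  have hcompact : IsCompact (K ∩ {d | ∑ i, |d i| = 1}) := by
    refine (isCompact_univ_pi fun _ => isCompact_Icc (a := (-1 : ℝ)) (b := 1)).of_isClosed_subset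
      (hK.inter (isClosed_eq (by fun_prop) continuous_const)) fun d hd i _ => abs_le.1 ?_
    exact hd.2 ▸ Finset.single_le_sum (f := fun i => |d i|) (fun _ _ => abs_nonneg _)
      (Finset.mem_univ i)
  obtain ⟨κ, hκ, hle⟩ := hcompact.exists_forall_le' (f := fun d => -(w ⬝ᵥ d)) (a := 0)
    (by simp only [dotProduct]; fun_prop) fun d hd => neg_pos.2 <| hneg d hd.1 fun h => by
      simpa [h] using hd.2
  refine ⟨κ, hκ, fun d hd => ?_⟩
  rcases eq_or_ne d 0 with rfl | hne
  · simp
  have hpos := sum_abs_pos hne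
  have hunit := hle ((∑ i, |d i|)⁻¹ • d) ⟨hsmul d hd _ (inv_nonneg.2 hpos.le), by
    simp only [Set.mem_ofPred_eq, Pi.smul_apply, smul_eq_mul, abs_mul, abs_of_pos (inv_pos.2 hpos),
      ← Finset.mul_sum]
    exact inv_mul_cancel₀ hpos.ne'⟩
  rwa [dotProduct_smul, smul_eq_mul, ← mul_neg, inv_mul_eq_div, le_div_iff₀ hpos] at hunit

end Gap

section Directions

open Filter Topology

variable {V C : Type*} [Fintype V]

/-- The directions that, at the point `xs`, point into the box `rbox X` and raise the load of each
constraint `c` that is tight at `xs` by at most `q c`. For `q = 0` this is the cone of feasible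
directions of the packing polytope at `xs`; other values of `q` describe paths of coordinate changes
that are still to be extended at an end. -/
def directionsWithLoad (A : Matrix C V ℝ) (b : C → ℝ) (X : V → ℕ) (xs : V → ℝ) (q : C → ℝ) :
    Set (V → ℝ) :=
  {d | (∀ v, (xs v = 0 → 0 ≤ d v) ∧ (xs v = X v → d v ≤ 0)) ∧
    ∀ c, (A *ᵥ xs) c = b c → (A *ᵥ d) c ≤ q c}

variable {A : Matrix C V ℝ} {b : C → ℝ} {X : V → ℕ} {xs : V → ℝ} {q r : C → ℝ} {d e : V → ℝ}

theorem zero_mem_directionsWithLoad (hq : ∀ c, (A *ᵥ xs) c = b c → 0 ≤ q c) :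
    0 ∈ directionsWithLoad A b X xs q :=
  ⟨by simp, by simpa using hq⟩

theorem add_mem_directionsWithLoad (hd : d ∈ directionsWithLoad A b X xs q)
    (he : e ∈ directionsWithLoad A b X xs r) : d + e ∈ directionsWithLoad A b X xs (q + r) := by
  refine ⟨fun v => ⟨fun h => ?_, fun h => ?_⟩, fun c hc => ?_⟩
  · exact add_nonneg ((hd.1 v).1 h) ((he.1 v).1 h)
  · exact add_nonpos ((hd.1 v).2 h) ((he.1 v).2 h)
  · rw [Matrix.mulVec_add]
    exact add_le_add (hd.2 c hc) (he.2 c hc)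

theorem directionsWithLoad_mono (h : q ≤ r) :
    directionsWithLoad A b X xs q ⊆ directionsWithLoad A b X xs r :=
  fun _ hd => ⟨hd.1, fun c hc => (hd.2 c hc).trans (h c)⟩

theorem smul_mem_directionsWithLoad_zero (hd : d ∈ directionsWithLoad A b X xs 0) {ε : ℝ}
    (hε : 0 ≤ ε) : ε • d ∈ directionsWithLoad A b X xs 0 := by
  refine ⟨fun v => ⟨fun h => ?_, fun h => ?_⟩, fun c hc => ?_⟩
  · exact mul_nonneg hε ((hd.1 v).1 h)
  · exact mul_nonpos_of_nonneg_of_nonpos hε ((hd.1 v).2 h)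
  · rw [Matrix.mulVec_smul]
    exact mul_nonpos_of_nonneg_of_nonpos hε (hd.2 c hc)

theorem isClosed_directionsWithLoad : IsClosed (directionsWithLoad A b X xs q) := by
  simp only [directionsWithLoad, Set.ofPred_and, Set.ofPred_forall, Matrix.mulVec, dotProduct]
  refine (isClosed_iInter fun v => .inter ?_ ?_).inter (isClosed_iInter fun c => ?_) <;>
    exact isClosed_iInter fun _ => isClosed_le (by fun_prop) (by fun_prop)

theorem sub_mem_directionsWithLoad_zero {x : V → ℝ} (hx : x ∈ packingPolytope A b X) :
    x - xs ∈ directionsWithLoad A b X xs 0 := by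
  refine ⟨fun v => ⟨fun h => ?_, fun h => ?_⟩, fun c hc => ?_⟩
  · simpa [h] using (hx.1 v).1
  · simpa [h] using (hx.1 v).2
  · simpa [Matrix.mulVec_sub, hc] using hx.2 c

theorem eventually_add_mul_le {a s u : ℝ} (h : a ≤ u) (h' : a = u → s ≤ 0) :
    ∀ᶠ ε in 𝓝[>] (0 : ℝ), a + ε * s ≤ u := by
  rcases h.eq_or_lt with h | h
  · filter_upwards [self_mem_nhdsWithin] with ε hε
    linarith [mul_nonpos_of_nonneg_of_nonpos (le_of_lt hε) (h' h)]
  · have htendsto : Tendsto (fun ε : ℝ => a + ε * s) (𝓝[>] 0) (𝓝 (a + 0 * s)) :=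
      (Continuous.tendsto (by fun_prop) 0).mono_left nhdsWithin_le_nhds
    rw [zero_mul, add_zero] at htendsto
    exact (htendsto.eventually_lt_const h).mono fun _ => le_of_lt

theorem exists_pos_add_smul_mem_packingPolytope [Finite C] (hxs : xs ∈ packingPolytope A b X)
    (hd : d ∈ directionsWithLoad A b X xs 0) :
    ∃ ε > (0 : ℝ), xs + ε • d ∈ packingPolytope A b X := by
  have hupper : ∀ᶠ ε in 𝓝[>] (0 : ℝ), ∀ v, xs v + ε * d v ≤ X v :=
    eventually_all.2 fun v => eventually_add_mul_le (hxs.1 v).2 (hd.1 v).2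
  have hlower : ∀ᶠ ε in 𝓝[>] (0 : ℝ), ∀ v, -xs v + ε * -d v ≤ 0 :=
    eventually_all.2 fun v => eventually_add_mul_le (neg_nonpos.2 (hxs.1 v).1)
      fun h => neg_nonpos.2 ((hd.1 v).1 (neg_eq_zero.1 h))
  have hload : ∀ᶠ ε in 𝓝[>] (0 : ℝ), ∀ c, (A *ᵥ xs) c + ε * (A *ᵥ d) c ≤ b c :=
    eventually_all.2 fun c => eventually_add_mul_le (hxs.2 c) (hd.2 c)
  obtain ⟨ε, ⟨⟨hupper, hlower⟩, hload⟩, hε⟩ :=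
    (((hupper.and hlower).and hload).and self_mem_nhdsWithin).exists
  refine ⟨ε, hε, fun v => ⟨?_, hupper v⟩, fun c => ?_⟩
  · simp only [Pi.add_apply, Pi.smul_apply, smul_eq_mul]
    linarith [hlower v]
  · simpa [Matrix.mulVec_add, Matrix.mulVec_smul] using hload c

variable [Finite C] {w : V → ℝ}

theorem dotProduct_neg_of_mem_directionsWithLoad (hopt : optSet (packingPolytope A b X) w = {xs})
    (hd : d ∈ directionsWithLoad A b X xs 0) (hne : d ≠ 0) : w ⬝ᵥ d < 0 := by
  have hxs : xs ∈ optSet (packingPolytope A b X) w := hopt ▸ rfl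
  obtain ⟨ε, hε, hmem⟩ := exists_pos_add_smul_mem_packingPolytope hxs.1 hd
  have hlt := dotProduct_lt_of_optSet_eq_singleton hopt hmem (by simp [hε.ne', hne])
  rw [dotProduct_add, dotProduct_smul, smul_eq_mul, add_lt_iff_neg_left] at hlt
  exact (pos_iff_neg_of_mul_neg hlt).1 hε

theorem cGap_pos (hopt : optSet (packingPolytope A b X) w = {xs})
    (hne : (packingPolytope A b X \ {xs}).Nonempty) : 0 < cGap (packingPolytope A b X) w xs := by
  obtain ⟨κ, hκ, hle⟩ := exists_pos_mul_sum_abs_le (w := w) isClosed_directionsWithLoad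
    (fun _ hd _ => smul_mem_directionsWithLoad_zero hd)
    fun _ => dotProduct_neg_of_mem_directionsWithLoad hopt
  refine hκ.trans_le (le_cGap hne fun x hx => ?_)
  have h := hle (x - xs) (sub_mem_directionsWithLoad_zero hx)
  rw [← dotProduct_neg, neg_sub] at h
  simpa only [Pi.sub_apply, abs_sub_comm (x _)] using h

theorem cGap_mul_sum_abs_le_neg_dotProduct (hxs : xs ∈ optSet (packingPolytope A b X) w)
    (hd : d ∈ directionsWithLoad A b X xs 0) :
    cGap (packingPolytope A b X) w xs * ∑ i, |d i| ≤ -(w ⬝ᵥ d) := by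
  obtain ⟨ε, hε, hmem⟩ := exists_pos_add_smul_mem_packingPolytope hxs.1 hd
  have hle := cGap_mul_sum_abs_le hxs hmem
  have hsum : ∑ i, |xs i - (xs + ε • d) i| = ε * ∑ i, |d i| := by
    simp [abs_mul, abs_of_pos hε, Finset.mul_sum]
  rw [hsum, sub_add_cancel_left, dotProduct_neg, dotProduct_smul, smul_eq_mul, ← mul_neg,
    mul_left_comm] at hle
  exact le_of_mul_le_mul_left hle hε

theorem exists_pos_mul_sum_abs_le_and_lt_mul (hopt : optSet (packingPolytope A b X) w = {xs})
    {ω τ : ℝ} (hτ : 0 < τ) (hω : ω / cGap (packingPolytope A b X) w xs < τ) :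
    ∃ κ > 0, (∀ d ∈ directionsWithLoad A b X xs 0, κ * ∑ i, |d i| ≤ -(w ⬝ᵥ d)) ∧ ω < κ * τ := by
  have hxs : xs ∈ optSet (packingPolytope A b X) w := hopt ▸ rfl
  by_cases hne : (packingPolytope A b X \ {xs}).Nonempty
  · have hpos := cGap_pos hopt hne
    exact ⟨_, hpos, fun d hd => cGap_mul_sum_abs_le_neg_dotProduct hxs hd,
      (div_lt_iff₀' hpos).1 hω⟩
  · -- Only the direction `0` is feasible and the gap is the junk value `0`, so take any large `κ`.
    refine ⟨|ω| / τ + 1, by positivity, fun d hd => ?_, ?_⟩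
    · obtain ⟨ε, hε, hmem⟩ := exists_pos_add_smul_mem_packingPolytope hxs.1 hd
      have hd0 : d = 0 := by
        by_contra hd0
        exact hne ⟨_, hmem, by simp [hε.ne', hd0]⟩
      simp [hd0]
    · rw [add_mul, div_mul_cancel₀ _ hτ.ne', one_mul]
      exact (le_abs_self ω).trans_lt (lt_add_of_pos_right _ hτ)

end Directions

section InwardSign

variable {V : Type*}

/-- The sign of the changes that coordinate `v` admits at a point `xs` with `xs v ∈ {0, X v}`. -/
noncomputable def inwardSign (xs : V → ℝ) (v : V) : ℝ := if xs v = 0 then 1 else -1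

/-- The letter `β'` of the alphabet `{0, …, X v}` of `v` is one unit closer to `xs v ∈ {0, X v}`
than the letter `β`. -/
structure IsStepToward (X : V → ℕ) (xs : V → ℝ) (v : V) (β β' : ℕ) : Prop where
  le : β ≤ X v
  le' : β' ≤ X v
  eq_add : (β : ℝ) = β' + inwardSign xs v

variable {X : V → ℕ} {xs : V → ℝ} {v : V} {β β' : ℕ}

theorem inwardSign_eq_or (xs : V → ℝ) (v : V) : inwardSign xs v = 1 ∨ inwardSign xs v = -1 :=
  ite_eq_or_eq _ _ _

theorem inwardSign_mul_self (xs : V → ℝ) (v : V) : inwardSign xs v * inwardSign xs v = 1 := by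
  rcases inwardSign_eq_or xs v with h | h <;> norm_num [h]

theorem inwardSign_mul_sub_nonneg {a : ℝ} (hxs : xs v = 0 ∨ xs v = X v) (ha : 0 ≤ a)
    (haX : a ≤ X v) : 0 ≤ inwardSign xs v * (a - xs v) := by
  unfold inwardSign
  split_ifs with h
  · simpa [h]
  · simpa [hxs.resolve_left h] using haX

theorem exists_isStepToward (hxs : xs v = 0 ∨ xs v = X v) (hβ : β ≤ X v) (hne : (β : ℝ) ≠ xs v) :
    ∃ β', IsStepToward X xs v β β' := by
  by_cases h : xs v = 0
  · obtain ⟨γ, rfl⟩ := Nat.exists_eq_succ_of_ne_zero (n := β) fun h0 => hne (by simp [h0, h])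
    exact ⟨γ, hβ, (Nat.le_succ γ).trans hβ, by simp [inwardSign, h]⟩
  · have hβX : β ≠ X v := fun h0 => hne (by rw [h0, hxs.resolve_left h])
    exact ⟨β + 1, hβ, by omega, by simp [inwardSign, h]⟩

theorem IsStepToward.ne_zero (h : IsStepToward X xs v β β') : X v ≠ 0 := by
  intro hX
  have hβ : β = β' := by have := h.le; have := h.le'; omega
  rcases inwardSign_eq_or xs v with hs | hs <;> simpa [hβ, hs] using h.eq_add

theorem IsStepToward.update_le [DecidableEq V] {z : V → ℕ} (hz : ∀ u, z u ≤ X u)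
    (h : IsStepToward X xs v β β') (u : V) : Function.update z v β' u ≤ X u := by
  rcases eq_or_ne u v with rfl | hu
  · simpa using h.le'
  · simpa [hu] using hz u

theorem IsStepToward.sum_update [DecidableEq V] {z : V → ℕ} {N : Finset V}
    (h : IsStepToward X xs v (z v) β') (hv : v ∈ N) :
    ∑ u ∈ N, (Function.update z v β' u : ℝ) = ∑ u ∈ N, (z u : ℝ) - inwardSign xs v := by
  rw [← Finset.add_sum_erase N _ hv, ← Finset.add_sum_erase N (fun u => (z u : ℝ)) hv, h.eq_add,
    Function.update_self, add_right_comm, add_sub_cancel_right]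
  congr 1
  exact Finset.sum_congr rfl fun u hu => by rw [Function.update_of_ne (Finset.ne_of_mem_erase hu)]

theorem exists_opposite_or_sum_update_le [DecidableEq V] {N : Finset V} {z : V → ℕ} {B : ℝ}
    (hxs : ∀ u, xs u = 0 ∨ xs u = X u) (hxsB : ∑ u ∈ N, xs u ≤ B) (hz : ∀ u, z u ≤ X u)
    (hzB : ∑ u ∈ N, (z u : ℝ) ≤ B) (hv : v ∈ N) (h : IsStepToward X xs v (z v) β') :
    (∃ u ∈ N, u ≠ v ∧ inwardSign xs u = -inwardSign xs v ∧ (z u : ℝ) ≠ xs u) ∨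
      ∑ u ∈ N, (Function.update z v β' u : ℝ) ≤ B ∧ (∑ u ∈ N, xs u = B → inwardSign xs v = -1) := by
  refine or_iff_not_imp_left.2 fun hopposite => ?_
  push Not at hopposite
  have hside : 0 ≤ inwardSign xs v * (∑ u ∈ N, (Function.update z v β' u : ℝ) - ∑ u ∈ N, xs u) := by
    rw [← Finset.sum_sub_distrib, Finset.mul_sum]
    refine Finset.sum_nonneg fun u hu => ?_
    by_cases hsign : inwardSign xs u = inwardSign xs v
    · rw [← hsign]
      exact inwardSign_mul_sub_nonneg (hxs u) (Nat.cast_nonneg _)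
        (Nat.cast_le.2 (h.update_le hz u))
    · have huv : u ≠ v := fun huv => hsign (by rw [huv])
      have hneg : inwardSign xs u = -inwardSign xs v := by
        rcases inwardSign_eq_or xs u with hu | hu <;> rcases inwardSign_eq_or xs v with hv | hv <;>
          simp_all
      simp [huv, hopposite u hu huv hneg]
  have hsum := h.sum_update hv
  rcases inwardSign_eq_or xs v with hs | hs <;> rw [hs] at hside hsum ⊢
  · exact ⟨by linarith, fun htight => by linarith⟩
  · exact ⟨by linarith, fun _ => rfl⟩

variable {C : Type*} [Fintype V] {A : Matrix C V ℝ} {b : C → ℝ} {q : C → ℝ} {w y : V → ℝ}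

theorem sum_abs_eq_inwardSign_dotProduct (hxs : ∀ v, xs v = 0 ∨ xs v = X v)
    (hy : y ∈ directionsWithLoad A b X xs q) : ∑ v, |y v| = inwardSign xs ⬝ᵥ y := by
  refine Finset.sum_congr rfl fun v _ => ?_
  by_cases h : xs v = 0
  · simp [inwardSign, h, abs_of_nonneg ((hy.1 v).1 h)]
  · simp [inwardSign, h, abs_of_nonpos ((hy.1 v).2 ((hxs v).resolve_left h))]

theorem add_smul_inwardSign_dotProduct_nonpos (hxs : ∀ v, xs v = 0 ∨ xs v = X v) {κ : ℝ}
    (hκ : ∀ d ∈ directionsWithLoad A b X xs 0, κ * ∑ v, |d v| ≤ -(w ⬝ᵥ d))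
    (hy : y ∈ directionsWithLoad A b X xs 0) : (w + κ • inwardSign xs) ⬝ᵥ y ≤ 0 := by
  have h := hκ y hy
  rw [sum_abs_eq_inwardSign_dotProduct hxs hy] at h
  rw [add_dotProduct, smul_dotProduct, smul_eq_mul]
  linarith

theorem single_inwardSign_mem_directionsWithLoad [DecidableEq V] (hX : X v ≠ 0) :
    Pi.single v (inwardSign xs v) ∈
      directionsWithLoad A b X xs fun c => A c v * inwardSign xs v := by
  refine ⟨fun u => ?_, fun c _ => by simp⟩
  rcases eq_or_ne u v with rfl | hu
  · refine ⟨fun h => by simp [inwardSign, h], fun h => ?_⟩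
    have h0 : xs u ≠ 0 := fun h0 => hX (by exact_mod_cast h.symm.trans h0)
    simp [inwardSign, h0]
  · simp [hu]

end InwardSign

section Exchange

variable {V C : Type*} [Fintype V]

/-- If the value `p` is attained, then it exceeds `p'` by at most `ρ ⬝ᵥ y + δ` for some direction
`y` with load `q`. Here `p` and `p'` are values of a message at two letters, the second one unit
closer to the optimum `xs`. -/
def Exchangeable (A : Matrix C V ℝ) (b : C → ℝ) (X : V → ℕ) (xs ρ : V → ℝ) (q : C → ℝ) (δ : ℝ)
    (p p' : WithBot ℝ) : Prop :=
  p ≠ ⊥ → ∃ y ∈ directionsWithLoad A b X xs q, p ≤ p' + ((ρ ⬝ᵥ y + δ : ℝ) : WithBot ℝ)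

variable {A : Matrix C V ℝ} {b : C → ℝ} {X : V → ℕ} {xs ρ w : V → ℝ} {q q' : C → ℝ} {δ δ' : ℝ}
  {p p' p₁ p₁' : WithBot ℝ}

theorem exchangeable_of_le (hq : ∀ c, (A *ᵥ xs) c = b c → 0 ≤ q c)
    (h : p ≤ p' + (δ : WithBot ℝ)) : Exchangeable A b X xs ρ q δ p p' :=
  fun _ => ⟨0, zero_mem_directionsWithLoad hq, by simpa using h⟩

theorem Exchangeable.mono (h : Exchangeable A b X xs ρ q δ p p') (hq : q ≤ q') (hδ : δ ≤ δ')
    (hp' : p' ≤ p₁') : Exchangeable A b X xs ρ q' δ' p p₁' := by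
  intro hp
  obtain ⟨y, hy, hle⟩ := h hp
  exact ⟨y, directionsWithLoad_mono hq hy,
    hle.trans (add_le_add hp' (WithBot.coe_le_coe.2 (by gcongr)))⟩

theorem Exchangeable.add (h : Exchangeable A b X xs ρ q δ p p')
    (h₁ : Exchangeable A b X xs ρ q' δ' p₁ p₁') :
    Exchangeable A b X xs ρ (q + q') (δ + δ') (p + p₁) (p' + p₁') := by
  intro hp
  rw [ne_eq, WithBot.add_eq_bot, not_or] at hp
  obtain ⟨y, hy, hle⟩ := h hp.1
  obtain ⟨y₁, hy₁, hle₁⟩ := h₁ hp.2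
  refine ⟨y + y₁, add_mem_directionsWithLoad hy hy₁, (add_le_add hle hle₁).trans_eq ?_⟩
  rw [add_add_add_comm, ← WithBot.coe_add, dotProduct_add, add_add_add_comm]

theorem Exchangeable.add_right (h : Exchangeable A b X xs ρ q δ p p') (a : WithBot ℝ) :
    Exchangeable A b X xs ρ q δ (p + a) (p' + a) := by
  have hrefl : Exchangeable A b X xs ρ 0 0 a a := exchangeable_of_le (by simp) (by simp)
  simpa using h.add hrefl

theorem Exchangeable.sum {ι : Type*} {S : Finset ι} {q : ι → C → ℝ} {δ : ι → ℝ}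
    {p p' : ι → WithBot ℝ} (h : ∀ i ∈ S, Exchangeable A b X xs ρ (q i) (δ i) (p i) (p' i)) :
    Exchangeable A b X xs ρ (∑ i ∈ S, q i) (∑ i ∈ S, δ i) (∑ i ∈ S, p i) (∑ i ∈ S, p' i) := by
  classical
  induction S using Finset.induction_on with
  | empty => exact exchangeable_of_le (by simp) (by simp)
  | insert i S hi ih =>
    simp only [Finset.sum_insert hi]
    exact (h i (S.mem_insert_self i)).add (ih fun j hj => h j (Finset.mem_insert_of_mem hj))

theorem Exchangeable.lt (h : Exchangeable A b X xs ρ 0 δ p p')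
    (hρ : ∀ y ∈ directionsWithLoad A b X xs 0, ρ ⬝ᵥ y ≤ 0) (hδ : δ < 0) (hp : p ≠ ⊥) : p < p' := by
  obtain ⟨y, hy, hle⟩ := h hp
  cases p' with
  | bot => exact absurd (by simpa using hle) hp
  | coe a =>
    refine hle.trans_lt ?_
    rw [← WithBot.coe_add, WithBot.coe_lt_coe]
    linarith [hρ y hy]

variable {κ : ℝ} {v : V} {β β' : ℕ}

theorem exchangeable_weight (h : IsStepToward X xs v β β') :
    Exchangeable A b X xs (w + κ • inwardSign xs) (fun c => A c v * inwardSign xs v) (-κ)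
      ((w v * β : ℝ) : WithBot ℝ) ((w v * β' : ℝ) : WithBot ℝ) := by
  classical
  refine fun _ => ⟨_, single_inwardSign_mem_directionsWithLoad h.ne_zero, ?_⟩
  rw [← WithBot.coe_add, WithBot.coe_le_coe, dotProduct_single, h.eq_add, Pi.add_apply,
    Pi.smul_apply, smul_eq_mul]
  linear_combination κ * (-inwardSign_mul_self xs v)

theorem exchangeable_weight_add_sum [DecidableEq C] (h : IsStepToward X xs v β β') {S : Finset C}
    {μ : C → ℕ → WithBot ℝ}
    (hμ : ∀ c ∈ S, Exchangeable A b X xs (w + κ • inwardSign xs) (Pi.single c (-inwardSign xs v)) δ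
      (μ c β) (μ c β')) :
    Exchangeable A b X xs (w + κ • inwardSign xs)
      (fun c => A c v * inwardSign xs v - if c ∈ S then inwardSign xs v else 0) (S.card * δ - κ)
      (((w v * β : ℝ) : WithBot ℝ) + ∑ c ∈ S, μ c β)
      (((w v * β' : ℝ) : WithBot ℝ) + ∑ c ∈ S, μ c β') := by
  refine ((exchangeable_weight h).add (Exchangeable.sum hμ)).mono (fun c => le_of_eq ?_)
    (le_of_eq ?_) le_rfl
  · rw [Pi.add_apply, Finset.sum_apply, Finset.sum_pi_single]
    split_ifs <;> ring
  · rw [Finset.sum_const, nsmul_eq_mul]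
    ring

end Exchange

namespace FactorGraphModel

variable {V C : Type*} [Fintype V] {F : FactorGraphModel V C} {z : V → ℕ} {t : ℕ} {u v : V}
  {β β' γ : ℕ}

theorem mem_zbox {X : V → ℕ} : z ∈ zbox X ↔ ∀ v, z v ≤ X v := by
  simp [zbox]

open Classical in
theorem sum_le_conUpdate {ν : V → C → ℕ → WithBot ℝ} {c : C} (hz : z ∈ zbox F.X)
    (hψ : F.ψ c z = 0) (v : V) :
    ∑ u ∈ (F.nbrC c).erase v, ν u c (z u) ≤ F.conUpdate ν c v (z v) :=
  Finset.le_sup (f := fun z : V → ℕ => ∑ u ∈ (F.nbrC c).erase v, ν u c (z u))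
    (Finset.mem_filter.2 ⟨hz, rfl, hψ⟩)

open Classical in
theorem exists_conUpdate_eq_sum {ν : V → C → ℕ → WithBot ℝ} {c : C}
    (h : F.conUpdate ν c v β ≠ ⊥) :
    ∃ z ∈ zbox F.X, z v = β ∧ F.ψ c z = 0 ∧
      F.conUpdate ν c v β = ∑ u ∈ (F.nbrC c).erase v, ν u c (z u) := by
  have hne : ((zbox F.X).filter fun z => z v = β ∧ F.ψ c z = 0).Nonempty := by
    refine Finset.nonempty_iff_ne_empty.2 fun hempty => h ?_
    rw [conUpdate, hempty, Finset.sup_empty]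
  obtain ⟨z, hz, hsup⟩ := Finset.exists_mem_eq_sup _ hne
    fun z : V → ℕ => ∑ u ∈ (F.nbrC c).erase v, ν u c (z u)
  obtain ⟨hbox, hzv, hψ⟩ := Finset.mem_filter.1 hz
  exact ⟨z, hbox, hzv, hψ, hsup⟩

open Classical in
theorem sum_le_conUpdate_update {ν : V → C → ℕ → WithBot ℝ} {c : C}
    (hz : Function.update z v β ∈ zbox F.X) (hψ : F.ψ c (Function.update z v β) = 0) :
    ∑ x ∈ (F.nbrC c).erase v, ν x c (z x) ≤ F.conUpdate ν c v β := by
  have hle := sum_le_conUpdate (ν := ν) hz hψ v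
  rw [Function.update_self] at hle
  refine (Finset.sum_congr rfl fun x hx => ?_).trans_le hle
  rw [Function.update_of_ne (Finset.ne_of_mem_erase hx)]

open Classical in
theorem add_sum_le_conUpdate_update_update {ν : V → C → ℕ → WithBot ℝ} {c : C} (hu : u ∈ F.nbrC c)
    (huv : u ≠ v) (hz : Function.update (Function.update z v β) u γ ∈ zbox F.X)
    (hψ : F.ψ c (Function.update (Function.update z v β) u γ) = 0) :
    ν u c γ + ∑ x ∈ ((F.nbrC c).erase v).erase u, ν x c (z x) ≤ F.conUpdate ν c v β := by
  rw [Function.update_comm huv.symm] at hz hψ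
  have hle := sum_le_conUpdate_update (ν := ν) hz hψ
  rw [← Finset.add_sum_erase _ _ (Finset.mem_erase.2 ⟨huv, hu⟩), Function.update_self] at hle
  refine (congrArg (ν u c γ + ·) (Finset.sum_congr rfl fun x hx => ?_)).trans_le hle
  rw [Function.update_of_ne (Finset.ne_of_mem_erase hx)]

variable [Fintype C]

theorem msgCV_ne_bot (hz : z ∈ zbox F.X) (hψ : ∀ c, F.ψ c z = 0) (t : ℕ) (c : C) (v : V) :
    F.msgCV t c v (z v) ≠ ⊥ := by
  classical
  induction t generalizing c v with
  | zero => simp [msgCV]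
  | succ t ih =>
    refine ne_bot_of_le_ne_bot ?_ (sum_le_conUpdate hz (hψ c) v)
    simp [varUpdate, WithBot.sum_eq_bot_iff, ih]

theorem belief_ne_bot (hz : z ∈ zbox F.X) (hψ : ∀ c, F.ψ c z = 0) (t : ℕ) (v : V) :
    F.belief t v (z v) ≠ ⊥ := by
  simp [belief, WithBot.sum_eq_bot_iff, msgCV_ne_bot hz hψ]

theorem belief_le_of_mem_delta (hβ : β ∈ F.delta t v) (hβ' : β' ≤ F.X v) :
    F.belief t v β' ≤ F.belief t v β := by
  rw [(Finset.mem_filter.1 hβ).2]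
  exact Finset.le_sup (Finset.mem_range_succ_iff.2 hβ')

theorem le_of_mem_delta (hβ : β ∈ F.delta t v) : β ≤ F.X v :=
  Finset.mem_range_succ_iff.1 (Finset.mem_filter.1 hβ).1

theorem minSumPacking_mem_delta (F : FactorGraphModel V C) (t : ℕ) (v : V) :
    F.minSumPacking t v ∈ F.delta t v := by
  unfold minSumPacking
  split_ifs
  exacts [Finset.max'_mem _ _, Finset.min'_mem _ _]

end FactorGraphModel

section PackingModel

open FactorGraphModel

variable {V C : Type*} [Fintype V] {A : Matrix C V ℝ} {b : C → ℝ} {w : V → ℝ} {X : V → ℕ}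
  {xs : V → ℝ}

theorem zero_mem_packingPolytope (hA : ∀ c v, 0 ≤ A c v)
    (hne : (packingPolytope A b X).Nonempty) : 0 ∈ packingPolytope A b X := by
  obtain ⟨x, hx⟩ := hne
  refine ⟨fun v => by simp, fun c => ?_⟩
  rw [Matrix.mulVec_zero]
  exact (Finset.sum_nonneg fun v _ => mul_nonneg (hA c v) (hx.1 v).1).trans (hx.2 c)

variable [Fintype C]

theorem mem_nbrV {c : C} {v : V} : c ∈ (packingModel A b w X).nbrV v ↔ A c v = 1 := by
  simp [nbrV, packingModel]

theorem mem_nbrC {c : C} {v : V} : v ∈ (packingModel A b w X).nbrC c ↔ A c v = 1 := by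
  simp [nbrC, packingModel]

theorem card_nbrV (v : V) : ((packingModel A b w X).nbrV v).card = {c | A c v = 1}.ncard := by
  rw [← Set.ncard_coe_finset]
  congr 1
  ext c
  simp [mem_nbrV]

theorem mulVec_eq_sum_nbrC (hA : ∀ c v, A c v = 0 ∨ A c v = 1) (c : C) (x : V → ℝ) :
    (A *ᵥ x) c = ∑ u ∈ (packingModel A b w X).nbrC c, x u := by
  classical
  rw [Matrix.mulVec, dotProduct, nbrC, Finset.sum_filter]
  refine Finset.sum_congr rfl fun u _ => ?_
  rcases hA c u with h | h <;> simp [packingModel, h]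

theorem ψ_eq_zero_iff {c : C} {z : V → ℕ} :
    (packingModel A b w X).ψ c z = 0 ↔
      ∑ u ∈ (packingModel A b w X).nbrC c, (z u : ℝ) ≤ b c := by
  classical
  simp [packingModel, nbrC]

theorem packingModel_belief_ne_bot_of_mem_delta (hb : 0 ∈ packingPolytope A b X) {t : ℕ} {v : V}
    {β : ℕ} (hβ : β ∈ (packingModel A b w X).delta t v) :
    (packingModel A b w X).belief t v β ≠ ⊥ := by
  refine ne_bot_of_le_ne_bot (belief_ne_bot (z := 0) (mem_zbox.2 fun _ => Nat.zero_le _)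
    (fun c => ψ_eq_zero_iff.2 ?_) t v) (belief_le_of_mem_delta hβ (Nat.zero_le _))
  simpa using hb.2 c

section Update

variable {ρ : V → ℝ} {κ δ ω : ℝ} {c : C} {v : V} {β β' : ℕ}

open Classical in
theorem exchangeable_conUpdate (hA : ∀ c v, A c v = 0 ∨ A c v = 1)
    (hxs : ∀ v, xs v = 0 ∨ xs v = X v) (hmem : xs ∈ packingPolytope A b X) (hδ : 0 ≤ δ)
    {ν : V → C → ℕ → WithBot ℝ}
    (hν : ∀ u β β', A c u = 1 → IsStepToward X xs u β β' →
      Exchangeable A b X xs ρ (Pi.single c (inwardSign xs u)) δ (ν u c β) (ν u c β'))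
    (hcv : A c v = 1) (h : IsStepToward X xs v β β') :
    Exchangeable A b X xs ρ (Pi.single c (-inwardSign xs v)) δ
      ((packingModel A b w X).conUpdate ν c v β) ((packingModel A b w X).conUpdate ν c v β') := by
  intro hbot
  obtain ⟨z, hz, rfl, hψ, hval⟩ := exists_conUpdate_eq_sum hbot
  rw [hval] at hbot ⊢
  refine (?_ : Exchangeable A b X xs ρ _ δ _ _) hbot
  replace hz : ∀ u, z u ≤ X u := mem_zbox.1 hz
  rw [ψ_eq_zero_iff] at hψ
  have hload := mulVec_eq_sum_nbrC (b := b) (w := w) (X := X) hA c xs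
  have hv : v ∈ (packingModel A b w X).nbrC c := mem_nbrC.2 hcv
  rcases exists_opposite_or_sum_update_le hxs (hload.symm.trans_le (hmem.2 c)) hz hψ hv h with
    ⟨u, hu, huv, hsign, hzu⟩ | ⟨hle, htight⟩
  · obtain ⟨γ, hγ⟩ := exists_isStepToward (hxs u) (hz u) hzu
    have hγ' : IsStepToward X xs u (Function.update z v β' u) γ := by
      rwa [Function.update_of_ne huv]
    have hfeasible : ∑ x ∈ (packingModel A b w X).nbrC c,
        (Function.update (Function.update z v β') u γ x : ℝ) ≤ b c := by
      rwa [hγ'.sum_update hu, h.sum_update hv, hsign, sub_neg_eq_add, sub_add_cancel]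
    rw [← Finset.add_sum_erase _ _ (Finset.mem_erase.2 ⟨huv, hu⟩), ← hsign]
    exact ((hν u _ _ (mem_nbrC.1 hu) hγ).add_right _).mono le_rfl le_rfl
      (add_sum_le_conUpdate_update_update hu huv (mem_zbox.2 (hγ'.update_le (h.update_le hz)))
        (ψ_eq_zero_iff.2 hfeasible))
  · have hmax := sum_le_conUpdate_update (ν := ν) (mem_zbox.2 (h.update_le hz))
      (ψ_eq_zero_iff.2 hle)
    refine exchangeable_of_le (fun c' hc' => ?_)
      (hmax.trans (le_add_of_nonneg_right (WithBot.coe_nonneg.2 hδ)))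
    rcases eq_or_ne c' c with rfl | hne
    · simp [htight (hload.symm.trans hc')]
    · simp [hne]

open Classical in
theorem exchangeable_varUpdate (hA : ∀ c v, A c v = 0 ∨ A c v = 1)
    (hcard : ((packingModel A b w X).nbrV v).card ≤ 2) (hδ : 0 ≤ δ) {μ : C → V → ℕ → WithBot ℝ}
    (h : IsStepToward X xs v β β')
    (hμ : ∀ c, A c v = 1 → Exchangeable A b X xs (w + κ • inwardSign xs)
      (Pi.single c (-inwardSign xs v)) δ (μ c v β) (μ c v β'))
    (hcv : A c v = 1) :
    Exchangeable A b X xs (w + κ • inwardSign xs) (Pi.single c (inwardSign xs v)) (δ - κ)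
      ((packingModel A b w X).varUpdate μ v c β) ((packingModel A b w X).varUpdate μ v c β') := by
  have hcard' : (((packingModel A b w X).nbrV v).erase c).card ≤ 1 := by
    rw [Finset.card_erase_of_mem (mem_nbrV.2 hcv)]
    omega
  refine (exchangeable_weight_add_sum (S := ((packingModel A b w X).nbrV v).erase c)
    (μ := fun c => μ c v) h fun c' hc' =>
      hμ c' (mem_nbrV.1 (Finset.mem_of_mem_erase hc'))).mono (fun c' => ?_) ?_ le_rfl
  · rcases eq_or_ne c' c with rfl | hne
    · simp [hcv]
    · rcases hA c' v with h | h <;> simp [hne, h, mem_nbrV]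
  · gcongr
    exact mul_le_of_le_one_left hδ (by exact_mod_cast hcard')

open Classical in
theorem exchangeable_varUpdate_msgCV_zero (hA : ∀ c v, A c v = 0 ∨ A c v = 1) (hκ : 0 ≤ κ)
    (hδ : 0 ≤ δ) (hw : w v ≤ δ) (hcv : A c v = 1) (h : IsStepToward X xs v β β') :
    Exchangeable A b X xs (w + κ • inwardSign xs) (Pi.single c (inwardSign xs v)) δ
      ((packingModel A b w X).varUpdate ((packingModel A b w X).msgCV 0) v c β)
      ((packingModel A b w X).varUpdate ((packingModel A b w X).msgCV 0) v c β') := by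
  have hval : ∀ γ : ℕ, (packingModel A b w X).varUpdate ((packingModel A b w X).msgCV 0) v c γ =
      ((w v * γ : ℝ) : WithBot ℝ) := fun γ => by simp [varUpdate, msgCV, packingModel]
  rw [hval, hval]
  rcases inwardSign_eq_or xs v with hs | hs
  · refine exchangeable_of_le (fun c' _ => ?_) ?_
    · rw [hs]
      exact (Pi.single_nonneg.2 zero_le_one : (0 : C → ℝ) ≤ Pi.single c 1) c'
    · rw [← WithBot.coe_add, WithBot.coe_le_coe, h.eq_add, hs]
      linarith
  · refine (exchangeable_weight h).mono (fun c' => ?_) (by linarith) le_rfl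
    rw [hs]
    rcases eq_or_ne c' c with rfl | hne
    · simp [hcv]
    · rcases hA c' v with h | h <;> simp [hne, h]

open Classical in
theorem exchangeable_varUpdate_msgCV (hA : ∀ c v, A c v = 0 ∨ A c v = 1)
    (hxs : ∀ v, xs v = 0 ∨ xs v = X v) (hmem : xs ∈ packingPolytope A b X)
    (hcard : ∀ v, ((packingModel A b w X).nbrV v).card ≤ 2) (hκ : 0 ≤ κ) (hω : ∀ v, w v ≤ ω)
    (t : ℕ) (hcv : A c v = 1) (h : IsStepToward X xs v β β') :
    Exchangeable A b X xs (w + κ • inwardSign xs) (Pi.single c (inwardSign xs v))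
      (max 0 (ω - κ * t))
      ((packingModel A b w X).varUpdate ((packingModel A b w X).msgCV t) v c β)
      ((packingModel A b w X).varUpdate ((packingModel A b w X).msgCV t) v c β') := by
  induction t generalizing v c β β' with
  | zero =>
    exact exchangeable_varUpdate_msgCV_zero hA hκ (le_max_left _ _) (by simp [hω v]) hcv h
  | succ t ih =>
    refine (exchangeable_varUpdate hA (hcard v) (le_max_left _ _) h (fun c' hc' =>
      exchangeable_conUpdate hA hxs hmem (le_max_left _ _) (fun _ _ _ => ih) hc' h) hcv).mono
      le_rfl ?_ le_rfl
    rw [sub_le_iff_le_add, Nat.cast_succ]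
    refine max_le (add_nonneg (le_max_left _ _) hκ) ?_
    linarith [le_max_right 0 (ω - κ * (t + 1))]

theorem exchangeable_belief_succ (hA : ∀ c v, A c v = 0 ∨ A c v = 1)
    (hxs : ∀ v, xs v = 0 ∨ xs v = X v) (hmem : xs ∈ packingPolytope A b X)
    (hcard : ∀ v, ((packingModel A b w X).nbrV v).card ≤ 2) (hκ : 0 ≤ κ) (hω : ∀ v, w v ≤ ω)
    (t : ℕ) (h : IsStepToward X xs v β β') :
    Exchangeable A b X xs (w + κ • inwardSign xs) 0 (2 * max 0 (ω - κ * t) - κ)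
      ((packingModel A b w X).belief (t + 1) v β)
      ((packingModel A b w X).belief (t + 1) v β') := by
  classical
  refine (exchangeable_weight_add_sum (S := (packingModel A b w X).nbrV v)
    (μ := fun c => (packingModel A b w X).msgCV (t + 1) c v) h fun c hc =>
      exchangeable_conUpdate hA hxs hmem (le_max_left _ _) (fun _ _ _ =>
        exchangeable_varUpdate_msgCV hA hxs hmem hcard hκ hω t) (mem_nbrV.1 hc) h).mono
    (fun c => ?_) ?_ le_rfl
  · rcases hA c v with h | h <;> simp [h, mem_nbrV]
  · gcongr
    exact_mod_cast hcard v

end Update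

section Belief

variable {t : ℕ} {v : V} {β β' : ℕ}

theorem belief_succ_lt_of_isStepToward (hA : ∀ c v, A c v = 0 ∨ A c v = 1)
    (hcard : ∀ v, ((packingModel A b w X).nbrV v).card ≤ 2)
    (hopt : optSet (packingPolytope A b X) w = {xs}) (hxs : ∀ v, xs v = 0 ∨ xs v = X v) {ω : ℝ}
    (hω : ∀ v, w v ≤ ω) (ht : ω / cGap (packingPolytope A b X) w xs < t + 1 / 2)
    (h : IsStepToward X xs v β β') (hbot : (packingModel A b w X).belief (t + 1) v β ≠ ⊥) :
    (packingModel A b w X).belief (t + 1) v β < (packingModel A b w X).belief (t + 1) v β' := by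
  have hmem : xs ∈ packingPolytope A b X := (hopt ▸ rfl : xs ∈ optSet _ w).1
  obtain ⟨κ, hκ, hgap, hlt⟩ :=
    exists_pos_mul_sum_abs_le_and_lt_mul hopt (by positivity : (0 : ℝ) < t + 1 / 2) ht
  have hloss : 2 * max 0 (ω - κ * t) - κ < 0 := by
    rcases max_cases 0 (ω - κ * t) with ⟨h, _⟩ | ⟨h, _⟩ <;> rw [h] <;> linarith
  exact (exchangeable_belief_succ hA hxs hmem hcard hκ.le hω t h).lt
    (fun y => add_smul_inwardSign_dotProduct_nonpos hxs hgap) hloss hbot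

theorem belief_zero_lt_of_isStepToward (hA : ∀ c v, 0 ≤ A c v)
    (hopt : optSet (packingPolytope A b X) w = {xs}) (hw : ∀ v, w v < 0)
    (h : IsStepToward X xs v β β') :
    (packingModel A b w X).belief 0 v β < (packingModel A b w X).belief 0 v β' := by
  have hmem : xs ∈ packingPolytope A b X := (hopt ▸ rfl : xs ∈ optSet _ w).1
  have hxs : xs = 0 := eq_zero_of_optSet_eq_singleton_of_nonpos hopt (fun x hx v => (hx.1 v).1)
    (zero_mem_packingPolytope hA ⟨xs, hmem⟩) fun v => (hw v).le
  have hval : ∀ γ : ℕ, (packingModel A b w X).belief 0 v γ = ((w v * γ : ℝ) : WithBot ℝ) :=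
    fun γ => by simp [belief, msgCV, packingModel]
  rw [hval, hval, WithBot.coe_lt_coe, h.eq_add, inwardSign, if_pos (by simp [hxs])]
  linarith [hw v]

theorem belief_lt_of_isStepToward (hA : ∀ c v, A c v = 0 ∨ A c v = 1)
    (hcard : ∀ v, ((packingModel A b w X).nbrV v).card ≤ 2)
    (hopt : optSet (packingPolytope A b X) w = {xs}) (hxs : ∀ v, xs v = 0 ∨ xs v = X v) {ω : ℝ}
    (hω : ∀ v, w v ≤ ω) (ht : ω / cGap (packingPolytope A b X) w xs + 1 / 2 < t)
    (h : IsStepToward X xs v β β') (hbot : (packingModel A b w X).belief t v β ≠ ⊥) :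
    (packingModel A b w X).belief t v β < (packingModel A b w X).belief t v β' := by
  cases t with
  | zero =>
    have hA0 : ∀ c v, 0 ≤ A c v := fun c v => by rcases hA c v with h | h <;> simp [h]
    have hxs_opt : xs ∈ optSet (packingPolytope A b X) w := hopt ▸ rfl
    have hω0 : ω < 0 := by
      by_contra! hω0
      have hquot := div_nonneg hω0 (cGap_nonneg hxs_opt)
      rw [Nat.cast_zero] at ht
      linarith
    exact belief_zero_lt_of_isStepToward hA0 hopt (fun v => (hω v).trans_lt hω0) h
  | succ t =>
    refine belief_succ_lt_of_isStepToward hA hcard hopt hxs hω ?_ h hbot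
    rw [Nat.cast_succ] at ht
    linarith

end Belief

end PackingModel

end MinSumPacking

open MinSumPacking FactorGraphModel in
theorem mainTheorem5_general {V C : Type*} [Fintype V] [Fintype C] (A : Matrix C V ℝ) (b : C → ℝ)
    (w : V → ℝ) (X : V → ℕ) (hA : ∀ c v, A c v = 0 ∨ A c v = 1)
    (hcol : ∀ v, {c | A c v = 1}.ncard ≤ 2) (xs : V → ℝ)
    (hopt : optSet (packingPolytope A b X) w = {xs}) (hxs : ∀ v, xs v = 0 ∨ xs v = (X v : ℝ))
    (t : ℕ) (ht : wMax w / cGap (packingPolytope A b X) w xs + 1 / 2 < (t : ℝ)) (v : V) :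
    ((packingModel A b w X).minSumPacking t v : ℝ) = xs v := by
  have hmem : xs ∈ packingPolytope A b X := (hopt ▸ rfl : xs ∈ optSet _ w).1
  have hA0 : ∀ c v, 0 ≤ A c v := fun c v => by rcases hA c v with h | h <;> simp [h]
  have hcard : ∀ v, ((packingModel A b w X).nbrV v).card ≤ 2 := fun v =>
    (card_nbrV v).trans_le (hcol v)
  have hω : ∀ v, w v ≤ wMax w := le_ciSup (Set.finite_range w).bddAbove
  have hdelta := minSumPacking_mem_delta (packingModel A b w X) t v
  have hbot := packingModel_belief_ne_bot_of_mem_delta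
    (zero_mem_packingPolytope hA0 ⟨xs, hmem⟩) hdelta
  by_contra hne
  obtain ⟨β', hstep⟩ := exists_isStepToward (hxs v) (le_of_mem_delta hdelta) hne
  have hlt := belief_lt_of_isStepToward hA hcard hopt hxs hω ht hstep hbot
  exact hlt.not_ge (belief_le_of_mem_delta hdelta hstep.le')

theorem mainTheorem5 {m n : ℕ} (A : Matrix (Fin m) (Fin n) ℝ) (b : Fin m → ℝ)
    (w : Fin n → ℝ) (X : Fin n → ℕ)
    (hA : ∀ j i, A j i = 0 ∨ A j i = 1)
    (hb : ∀ j, 0 ≤ b j)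
    (hcol : ∀ i, {j | A j i = 1}.ncard ≤ 2)
    (xs : Fin n → ℝ)
    (hopt : MinSumPacking.optSet (MinSumPacking.packingPolytope A b X) w = {xs})
    (hxs : ∀ i, xs i = 0 ∨ xs i = (X i : ℝ))
    (t : ℕ)
    (ht : MinSumPacking.wMax w /
        MinSumPacking.cGap (MinSumPacking.packingPolytope A b X) w xs + 1 / 2 < (t : ℝ)) :
    ∀ i, (((MinSumPacking.packingModel A b w X).minSumPacking t i : ℕ) : ℝ) = xs i :=
  mainTheorem5_general A b w X hA hcol xs hopt hxs t ht
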